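/- Let $q$ be an odd prime power and let $\ell,d$ be positive integers with $0<d<2\ell$, $\gcd(\ell,d)=1$. Let $\omega\in\mathbb F_{q^{2\ell}}\setminus\mathbb F_{q^\ell}$ with $\omega^{q^\ell}=-\omega$ and let $\beta\in\mathbb F_{q^{2\ell}}^*$ be such that $$\beta^{\frac{q^{2\ell}-1}{\gcd(q^\ell+1,\,q^d+1)}}\neq 1,$$ and assume that there is no $a\in\mathbb F_{q^{2\ell}}^*$ with $a+a^{q^\ell}=a+a^{q^d}=0$. Let $\overline{BH}(q,\ell,d,\beta)$ be the presemifield $(\mathbb F_{q^{2\ell}},+,\star)$ with $$x\star y=xy^{q^\ell}+x^{q^\ell}y+\bigl[\beta(xy^{q^d}+x^{q^d}y)+\beta^{q^\ell}(xy^{q^d}+x^{q^d}y)^{q^\ell}\bigr]\omega .$$ A Bierbrauer presemifield is $(\mathbb F_{Q^{4m}},+,\star')$, where $Q$ is an odd prime power, $m,n$ are positive integers with $0<n<4m$, $\gcd(m,n)=1$, $\frac{2m}{\gcd(2m,n)}$ odd, $Q^m\equiv Q^n\equiv 1\pmod 4$, and $$x\star' y=y^{Q^n}x+yx^{Q^n}-v\bigl(y^{Q^{m+n}}x^{Q^{3m}}+y^{Q^{3m}}x^{Q^{m+n}}\bigr),\qquad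 v=u^{Q^m-1},$$ with $u$ a primitive element of $\mathbb F_{Q^{4m}}$ (a generator of its multiplicative group). Two presemifields $(S,+,\star)$ and $(S',+,\star')$ are isotopic if there are additive bijections $g_1,g_2,g_3:S\to S'$ (equivalently, invertible $\mathbb F_p$-linear maps, $p$ being the common characteristic) with $g_1(x)\star' g_2(y)=g_3(x\star y)$ for all $x,y\in S$. If $\ell$ is not of the form $2k$ with $k$ odd, then $\overline{BH}(q,\ell,d,\beta)$ is not isotopic to any Bierbrauer presemifield (for any values of $Q,m,n,u$). -/

import Mathlib

/-- Two (pre)semifield multiplications `mul` on `S` and `mul'` on `S'` are isotopic if there are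
invertible additive maps `g₁, g₂, g₃ : S → S'` with `g₁ x ⋆' g₂ y = g₃ (x ⋆ y)` for all `x, y`.
(Between elementary abelian `p`-groups additive maps are the same as `𝔽_p`-linear maps, and
there is no additive bijection between nontrivial groups of different characteristics.) -/
def PresemifieldIsotopic {S S' : Type*} [AddCommGroup S] [AddCommGroup S']
    (mul : S → S → S) (mul' : S' → S' → S') : Prop :=
  ∃ g₁ g₂ g₃ : S ≃+ S', ∀ x y : S, mul' (g₁ x) (g₂ y) = g₃ (mul x y)

/-- The multiplication of the Budaghyan–Helleseth presemifield `BH(q, ℓ, d, β)` on a field `F`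
with `q ^ (2ℓ)` elements:
`x ⋆ y = x y^(q^ℓ) + x^(q^ℓ) y
  + [β (x y^(q^d) + x^(q^d) y) + β^(q^ℓ) (x y^(q^d) + x^(q^d) y)^(q^ℓ)] ω`. -/
def bhMul {F : Type*} [Field F] (q ℓ d : ℕ) (β ω : F) (x y : F) : F :=
  x * y ^ q ^ ℓ + x ^ q ^ ℓ * y
    + (β * (x * y ^ q ^ d + x ^ q ^ d * y)
        + β ^ q ^ ℓ * (x * y ^ q ^ d + x ^ q ^ d * y) ^ q ^ ℓ) * ω

/-- `bhMul q ℓ d β ω` is the multiplication of a Budaghyan–Helleseth presemifield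
of order `q ^ (2ℓ)` with underlying field `F`. -/
structure IsBHData (F : Type*) [Field F] (q ℓ d : ℕ) (β ω : F) : Prop where
  primePow : IsPrimePow q
  odd : Odd q
  card : Nat.card F = q ^ (2 * ℓ)
  d_pos : 0 < d
  d_lt : d < 2 * ℓ
  coprime : Nat.Coprime ℓ d
  /-- `ω` is not in the subfield with `q ^ ℓ` elements -/
  omega_notMem : ω ^ q ^ ℓ ≠ ω
  omega_conj : ω ^ q ^ ℓ = -ω
  beta_ne_zero : β ≠ 0
  beta_pow : β ^ ((q ^ (2 * ℓ) - 1) / Nat.gcd (q ^ ℓ + 1) (q ^ d + 1)) ≠ 1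
  no_common_root : ¬ ∃ a : F, a ≠ 0 ∧ a + a ^ q ^ ℓ = 0 ∧ a + a ^ q ^ d = 0

/-- The multiplication of a Bierbrauer presemifield on a field `F` with `q ^ (4m)` elements:
`x ⋆ y = y^(q^n) x + y x^(q^n) - v (y^(q^(m+n)) x^(q^(3m)) + y^(q^(3m)) x^(q^(m+n)))`
with `v = u^(q^m - 1)`. -/
def bierbrauerMul {F : Type*} [Field F] (q m n : ℕ) (u : F) (x y : F) : F :=
  y ^ q ^ n * x + y * x ^ q ^ n
    - u ^ (q ^ m - 1)
        * (y ^ q ^ (m + n) * x ^ q ^ (3 * m) + y ^ q ^ (3 * m) * x ^ q ^ (m + n))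

/-- `bierbrauerMul q m n u` is the multiplication of a Bierbrauer presemifield
of order `q ^ (4m)` with underlying field `F`. -/
structure IsBierbrauerData (F : Type*) [Field F] (q m n : ℕ) (u : F) : Prop where
  primePow : IsPrimePow q
  odd : Odd q
  card : Nat.card F = q ^ (4 * m)
  n_pos : 0 < n
  n_lt : n < 4 * m
  coprime : Nat.Coprime m n
  odd_quot : Odd (2 * m / Nat.gcd (2 * m) n)
  pow_m_mod : q ^ m ≡ 1 [MOD 4]
  pow_n_mod : q ^ n ≡ 1 [MOD 4]
  /-- `u` generates the multiplicative group of `F` -/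
  primitive : IsPrimitiveRoot u (q ^ (4 * m) - 1)

/-! ### Additive maps as linearized polynomials -/

section AutExpansion

variable {K F : Type*} [Field K] [Field F] [Algebra K F]

/-! The order of the middle nucleus is an isotopy invariant
(`PresemifieldIsotopic.card_middleNucleus`), and both families have middle nucleus of order the
square of their parameter: `q ^ 2` and `Q ^ 2`. Isotopy thus forces `q = Q`; comparing `q ^ (2ℓ)`
with `q ^ (4m)` gives `ℓ = 2m`. The Bierbrauer conditions make `m` odd, which is the excluded shape
of `ℓ`.

To compute a nucleus, write the additive maps in `A x ⋆ y = x ⋆ B y` as combinations of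
automorphisms, and compare coefficients of `σ x * τ y`, which is legitimate by Dedekind
independence. For Bierbrauer, `A` and `B` reduce to multiplication by one element fixed by `φ ^ 2`,
where `φ` is the `Q`-Frobenius. For Budaghyan–Helleseth, with `φ` the `q`-Frobenius, `A x = a * x +
c * x ^ q ^ ℓ`, where `a` and `c / c₀` are fixed by `ψ = φ ^ (ℓ + d)`. Since `ψ` generates the same
group as `φ`, each ranges over `q` values. -/

theorem linearIndependent_algEquiv_coe :
    LinearIndependent F (fun σ : F ≃ₐ[K] F => (σ : F → F)) :=
  (linearIndependent_monoidHom F F).comp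
    (fun σ : F ≃ₐ[K] F => ((σ : F ≃* F) : F →* F)) fun _ _ h =>
      AlgEquiv.ext fun x => DFunLike.congr_fun h x

variable [FiniteDimensional K F]

theorem eq_zero_of_sum_algEquiv_eq_zero (a : (F ≃ₐ[K] F) → F)
    (h : ∀ x, ∑ σ, a σ * σ x = 0) : a = 0 := by
  have := Fintype.linearIndependent_iff.1 (linearIndependent_algEquiv_coe (K := K) (F := F)) a
    (by ext x; simpa using h x)
  exact funext this

/-- Every `K`-linear endomorphism of a finite Galois extension is a linear combination of
automorphisms. -/
theorem exists_eq_sum_algEquiv [IsGalois K F] (A : F →ₗ[K] F) :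
    ∃ a : (F ≃ₐ[K] F) → F, ∀ x, A x = ∑ σ, a σ * σ x := by
  have hli : LinearIndependent F (fun σ : F ≃ₐ[K] F => (σ.toLinearMap : F →ₗ[K] F)) := by
    rw [Fintype.linearIndependent_iff]
    intro g hg
    refine congrFun (eq_zero_of_sum_algEquiv_eq_zero g fun x => ?_)
    simpa using LinearMap.congr_fun hg x
  -- Independent automorphisms span because their number is the dimension.
  have hcard : Fintype.card (F ≃ₐ[K] F) = Module.finrank F (F →ₗ[K] F) := by
    rw [Module.finrank_linearMap_self, ← IsGalois.card_aut_eq_finrank, Nat.card_eq_fintype_card]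
  have hmem : A ∈ Submodule.span F (Set.range fun σ : F ≃ₐ[K] F => (σ.toLinearMap : F →ₗ[K] F)) := by
    rw [hli.span_eq_top_of_card_eq_finrank' hcard]
    trivial
  obtain ⟨a, ha⟩ := (Submodule.mem_span_range_iff_exists_fun F).1 hmem
  exact ⟨a, fun x => by simp [← ha]⟩

/-- The function of two variables with coefficient matrix `c` in the products `σ x * τ y`. -/
noncomputable def autBilin (c : (F ≃ₐ[K] F) → (F ≃ₐ[K] F) → F) (x y : F) : F :=
  ∑ σ, ∑ τ, c σ τ * σ x * τ y

theorem autBilin_add (c c' : (F ≃ₐ[K] F) → (F ≃ₐ[K] F) → F) (x y : F) :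
    autBilin (c + c') x y = autBilin c x y + autBilin c' x y := by
  simp [autBilin, add_mul, Finset.sum_add_distrib]

theorem autBilin_sub (c c' : (F ≃ₐ[K] F) → (F ≃ₐ[K] F) → F) (x y : F) :
    autBilin (c - c') x y = autBilin c x y - autBilin c' x y := by
  simp [autBilin, sub_mul, Finset.sum_sub_distrib]

theorem autBilin_swap (c : (F ≃ₐ[K] F) → (F ≃ₐ[K] F) → F) (x y : F) :
    autBilin (fun σ τ => c τ σ) x y = autBilin c y x := by
  rw [autBilin, autBilin, Finset.sum_comm]
  exact Finset.sum_congr rfl fun σ _ => Finset.sum_congr rfl fun τ _ => by ring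

/-- Dedekind independence is applied once in each variable. -/
theorem autBilin_injective {c c' : (F ≃ₐ[K] F) → (F ≃ₐ[K] F) → F}
    (h : ∀ x y, autBilin c x y = autBilin c' x y) : c = c' := by
  rw [← sub_eq_zero]
  ext σ τ
  refine congrFun (eq_zero_of_sum_algEquiv_eq_zero _ fun y => ?_) τ
  refine congrFun (eq_zero_of_sum_algEquiv_eq_zero
    (fun σ => ∑ τ, (c - c') σ τ * τ y) fun x => ?_) σ
  rw [← sub_eq_zero.2 (h x y), ← autBilin_sub, autBilin]
  refine Finset.sum_congr rfl fun σ _ => ?_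
  rw [Finset.sum_mul]
  exact Finset.sum_congr rfl fun τ _ => by ring

open Classical in
/-- Coefficients of `k * ρ (A x) * κ y` where `A x = ∑ σ, a σ * σ x`. -/
noncomputable def leftCoeff (k : F) (ρ κ : F ≃ₐ[K] F) (a : (F ≃ₐ[K] F) → F) (σ τ : F ≃ₐ[K] F) : F :=
  if τ = κ then k * ρ (a (ρ⁻¹ * σ)) else 0

theorem map_sum_algEquiv (ρ : F ≃ₐ[K] F) (a : (F ≃ₐ[K] F) → F) (x : F) :
    ρ (∑ σ, a σ * σ x) = ∑ σ, ρ (a (ρ⁻¹ * σ)) * σ x := by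
  rw [map_sum, ← Equiv.sum_comp (Equiv.mulLeft ρ) fun σ => ρ (a (ρ⁻¹ * σ)) * σ x]
  simp

theorem autBilin_leftCoeff (k : F) (ρ κ : F ≃ₐ[K] F) (a : (F ≃ₐ[K] F) → F) (x y : F) :
    autBilin (leftCoeff k ρ κ a) x y = k * ρ (∑ σ, a σ * σ x) * κ y := by
  rw [map_sum_algEquiv, Finset.mul_sum, Finset.sum_mul]
  refine Finset.sum_congr rfl fun σ _ => ?_
  rw [Finset.sum_eq_single κ (fun τ _ h => by simp [leftCoeff, h]) (by simp)]
  simp [leftCoeff, mul_assoc]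

end AutExpansion

/-! ### Frobenius and fixed fields -/

section FiniteFieldAut

variable {p : ℕ} [Fact p.Prime] {F : Type*} [Field F] [Finite F] [Algebra (ZMod p) F]

/-- By Galois theory `F` has degree `K` over the fixed field of `ψ`, so the order of that field has
`K`-th power `q ^ K`. -/
theorem card_fixed_algEquiv {q K : ℕ} (hK : K ≠ 0) (hcard : Nat.card F = q ^ K)
    (ψ : F ≃ₐ[ZMod p] F) (hψ : orderOf ψ = K) : Nat.card {x : F // ψ x = x} = q := by
  have h1 := IntermediateField.finrank_fixedField_eq_card (Subgroup.zpowers ψ)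
  rw [Nat.card_zpowers, hψ] at h1
  have h2 := Module.natCard_eq_pow_finrank
    (K := IntermediateField.fixedField (Subgroup.zpowers ψ)) (V := F)
  rw [h1, hcard] at h2
  rw [Nat.pow_left_injective hK h2]
  refine Nat.card_congr (Equiv.subtypeEquivRight fun x => ?_)
  rw [IntermediateField.mem_fixedField_iff]
  refine ⟨fun h f hf => ?_, fun h => h ψ (Subgroup.mem_zpowers ψ)⟩
  have : Subgroup.zpowers ψ ≤ MulAction.stabilizer (F ≃ₐ[ZMod p] F) x := by
    rw [Subgroup.zpowers_le]
    exact h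
  exact this hf

theorem addMonoidHom_eq_sum_algEquiv (A : F →+ F) :
    ∃ a : (F ≃ₐ[ZMod p] F) → F, ∀ x, A x = ∑ σ, a σ * σ x :=
  exists_eq_sum_algEquiv (A.toZModLinearMap p)

omit [Finite F] in
theorem algEquiv_pow_apply {q : ℕ} (φ : F ≃ₐ[ZMod p] F) (hφ : ∀ x, φ x = x ^ q) (k : ℕ) (x : F) :
    (φ ^ k) x = x ^ q ^ k := by
  induction k with
  | zero => simp
  | succ k ih => rw [pow_succ', AlgEquiv.mul_apply, ih, hφ, ← pow_mul, pow_succ]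

end FiniteFieldAut

theorem exists_frobenius {F : Type*} [Field F] {q K : ℕ} (hq : IsPrimePow q)
    (hcard : Nat.card F = q ^ K) :
    ∃ (p : ℕ) (_ : Fact p.Prime) (_ : Algebra (ZMod p) F) (φ : F ≃ₐ[ZMod p] F),
      Finite F ∧ p ∣ q ∧ (∀ x, φ x = x ^ q) ∧ orderOf φ = K := by
  obtain ⟨p, a, hp, ha, rfl⟩ := hq
  have hp : p.Prime := hp.nat_prime
  have : Fact p.Prime := ⟨hp⟩
  have hfin : Finite F := Nat.finite_of_card_ne_zero (by
    rw [hcard]; exact pow_ne_zero _ (pow_ne_zero _ hp.ne_zero))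
  have hchar : CharP F p := by
    have : Fintype F := Fintype.ofFinite F
    obtain ⟨r, hr⟩ := CharP.exists F
    have hrp : r.Prime := (CharP.char_is_prime_or_zero F r).resolve_right
      (CharP.char_ne_zero_of_finite F r)
    have : Fact r.Prime := ⟨hrp⟩
    obtain ⟨n, -, hn⟩ := FiniteField.card F r
    rw [← Nat.card_eq_fintype_card, hcard] at hn
    have : r ∣ (p ^ a) ^ K := hn ▸ dvd_pow_self r n.ne_zero
    have : r = p := (Nat.prime_dvd_prime_iff_eq hrp hp).1
      (hrp.dvd_of_dvd_pow (hrp.dvd_of_dvd_pow this))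
    exact this ▸ hr
  let _ : Algebra (ZMod p) F := ZMod.algebra F p
  have hfr : Module.finrank (ZMod p) F = a * K := by
    have h := Module.natCard_eq_pow_finrank (K := ZMod p) (V := F)
    rw [hcard, Nat.card_zmod, ← pow_mul] at h
    exact (Nat.pow_right_injective hp.two_le h).symm
  let f := FiniteField.frobeniusAlgEquivOfAlgebraic (ZMod p) F
  have hf : ∀ x, f x = x ^ p := fun x => by
    simp [f, ZMod.card]
  refine ⟨p, ‹_›, ‹_›, f ^ a, hfin, dvd_pow_self p ha.ne', algEquiv_pow_apply f hf a, ?_⟩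
  rw [orderOf_pow_of_dvd ha.ne', FiniteField.orderOf_frobeniusAlgEquivOfAlgebraic, hfr,
    Nat.mul_div_cancel_left _ ha]
  rw [FiniteField.orderOf_frobeniusAlgEquivOfAlgebraic, hfr]
  exact dvd_mul_right _ _

/-! ### The middle nucleus as an isotopy invariant -/

section MiddleNucleus

/-- The pairs `(A, B)` of additive maps with `A x ⋆ y = x ⋆ B y`; the projection to the first
component identifies them with the middle nucleus of a presemifield. -/
def MiddleNucleus {S : Type*} [AddCommGroup S] (mul : S → S → S) : Type _ :=
  {P : (S →+ S) × (S →+ S) // ∀ x y, mul (P.1 x) y = mul x (P.2 y)}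

/-- Conjugating `A` by `g₁` and `B` by `g₂` carries one nucleus onto the other. -/
theorem PresemifieldIsotopic.card_middleNucleus {S S' : Type*} [AddCommGroup S] [AddCommGroup S']
    {mul : S → S → S} {mul' : S' → S' → S'} (h : PresemifieldIsotopic mul mul') :
    Nat.card (MiddleNucleus mul) = Nat.card (MiddleNucleus mul') := by
  obtain ⟨g₁, g₂, g₃, hg⟩ := h
  refine Nat.card_congr (Equiv.subtypeEquiv
    ((g₁.addMonoidHomCongrLeftEquiv.trans g₁.addMonoidHomCongrRightEquiv).prodCongr
      (g₂.addMonoidHomCongrLeftEquiv.trans g₂.addMonoidHomCongrRightEquiv)) fun P => ?_)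
  rw [g₁.symm.surjective.forall]
  refine forall_congr' fun x => ?_
  rw [g₂.symm.surjective.forall]
  refine forall_congr' fun y => ?_
  rw [← g₃.injective.eq_iff, ← hg, ← hg]
  simp [AddEquiv.addMonoidHomCongrLeftEquiv, AddEquiv.addMonoidHomCongrRightEquiv]

end MiddleNucleus

/-! ### The middle nucleus of a Bierbrauer presemifield -/

section Bierbrauer

variable {p : ℕ} {F : Type*} [Field F] [Finite F] [Fact p.Prime] [Algebra (ZMod p) F]

/-- Coefficients of the bilinear map
`ν y * A x + y * ν (A x) - v * (κ y * ρ (A x) + ρ y * κ (A x))`, where `A x = ∑ σ, a σ * σ x`. -/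
noncomputable def bierbrauerCoeff (ν κ ρ : F ≃ₐ[ZMod p] F) (v : F)
    (a : (F ≃ₐ[ZMod p] F) → F) : (F ≃ₐ[ZMod p] F) → (F ≃ₐ[ZMod p] F) → F :=
  leftCoeff 1 1 ν a + leftCoeff 1 ν 1 a - (leftCoeff v ρ κ a + leftCoeff v κ ρ a)

theorem autBilin_bierbrauerCoeff {q m n : ℕ} {u : F} (φ : F ≃ₐ[ZMod p] F) (hφ : ∀ x, φ x = x ^ q)
    {A : F → F} {a : (F ≃ₐ[ZMod p] F) → F} (ha : ∀ x, A x = ∑ σ, a σ * σ x) (x y : F) :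
    autBilin (bierbrauerCoeff (φ ^ n) (φ ^ (m + n)) (φ ^ (3 * m)) (u ^ (q ^ m - 1)) a) x y =
      bierbrauerMul q m n u (A x) y := by
  simp only [bierbrauerCoeff, autBilin_sub, autBilin_add, autBilin_leftCoeff, ← ha,
    algEquiv_pow_apply φ hφ, bierbrauerMul, AlgEquiv.one_apply]
  ring

theorem bierbrauerMul_comm {F : Type*} [Field F] (q m n : ℕ) (u x y : F) :
    bierbrauerMul q m n u x y = bierbrauerMul q m n u y x := by
  simp only [bierbrauerMul]
  ring

theorem bierbrauerCoeff_eq_swap {q m n : ℕ} {u : F} (φ : F ≃ₐ[ZMod p] F)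
    (hφ : ∀ x, φ x = x ^ q) {A B : F → F} {a b : (F ≃ₐ[ZMod p] F) → F}
    (ha : ∀ x, A x = ∑ σ, a σ * σ x) (hb : ∀ x, B x = ∑ σ, b σ * σ x)
    (h : ∀ x y, bierbrauerMul q m n u (A x) y = bierbrauerMul q m n u x (B y))
    (σ τ : F ≃ₐ[ZMod p] F) :
    bierbrauerCoeff (φ ^ n) (φ ^ (m + n)) (φ ^ (3 * m)) (u ^ (q ^ m - 1)) a σ τ =
      bierbrauerCoeff (φ ^ n) (φ ^ (m + n)) (φ ^ (3 * m)) (u ^ (q ^ m - 1)) b τ σ := by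
  refine congrFun₂ (autBilin_injective (c' := fun σ τ => bierbrauerCoeff _ _ _ _ b τ σ)
    fun x y => ?_) σ τ
  rw [autBilin_bierbrauerCoeff φ hφ ha, h, bierbrauerMul_comm, ← autBilin_bierbrauerCoeff φ hφ hb,
    autBilin_swap]

variable {φ : F ≃ₐ[ZMod p] F} {m n : ℕ}

omit [Finite F] in
theorem algEquiv_pow_ne (hφ : orderOf φ = 4 * m) {i j : ℕ}
    (h : ¬ (4 : ℤ) ∣ (i : ℤ) - j) : φ ^ i ≠ φ ^ j := fun e => by
  rw [pow_eq_pow_iff_modEq, hφ] at e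
  refine h (dvd_trans ?_ (Nat.modEq_iff_dvd.1 e.symm))
  push_cast
  exact dvd_mul_right _ _

omit [Finite F] in
-- Nonzero coefficients can only sit in rows and columns limited by `1, ν, κ, ρ`. Exponents of `φ`
-- make sense modulo 4, and the parities of `m` and `n` rule out all coincidences except `n = 2m`,
-- which is treated separately.
theorem bierbrauerCoeff_support {v : F} {a b : (F ≃ₐ[ZMod p] F) → F}
    {ν κ ρ : F ≃ₐ[ZMod p] F} (hν : ν = φ ^ n) (hκ : κ = φ ^ (m + n)) (hρ : ρ = φ ^ (3 * m))
    (hφ : orderOf φ = 4 * m) (hm : Odd m) (hn : Even n)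
    (hn0 : 0 < n) (hn4 : n < 4 * m) (hv : 2 * v ≠ 0)
    (hE : ∀ σ τ, bierbrauerCoeff ν κ ρ v a σ τ = bierbrauerCoeff ν κ ρ v b τ σ)
    (σ : F ≃ₐ[ZMod p] F) (hσ : σ ≠ 1) : a σ = 0 := by
  have h0 : (1 : F ≃ₐ[ZMod p] F) = φ ^ 0 := (pow_zero φ).symm
  obtain ⟨m', hm⟩ := hm
  obtain ⟨n', hn⟩ := hn
  have n1 : ν ≠ 1 := hν ▸ pow_ne_one_of_lt_orderOf hn0.ne' (hφ ▸ hn4)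
  have n2 : ν ≠ κ := by rw [hν, hκ]; exact algEquiv_pow_ne hφ (by omega)
  have n3 : ν ≠ ρ := by rw [hν, hρ]; exact algEquiv_pow_ne hφ (by omega)
  have n4 : 1 ≠ κ := by rw [h0, hκ]; exact algEquiv_pow_ne hφ (by omega)
  have n5 : 1 ≠ ρ := by rw [h0, hρ]; exact algEquiv_pow_ne hφ (by omega)
  by_contra h
  -- Entry `(σ, ν)` is `a σ` on the left; the right side vanishes off these four values. Entry `(ν *
  -- σ, 1)` similarly isolates `ν (a σ)`.
  have s1 : σ = 1 ∨ σ = ν ∨ σ = κ ∨ σ = ρ := by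
    by_contra! hc
    refine h ?_
    simpa [bierbrauerCoeff, leftCoeff, hc.1, hc.2.1, hc.2.2.1, hc.2.2.2, n1, n2, n3]
      using hE σ ν
  have s2 : ν * σ = 1 ∨ ν * σ = ν ∨ ν * σ = κ ∨ ν * σ = ρ := by
    by_contra! hc
    refine h ?_
    simpa [bierbrauerCoeff, leftCoeff, hc.1, hc.2.1, hc.2.2.1, hc.2.2.2, n1.symm, n4, n5]
      using hE (ν * σ) 1
  have h3 : σ = ν ∧ ν * ν = 1 := by
    rw [hκ, hρ] at s1 s2
    rcases s1 with s | s | s | s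
    · exact absurd s hσ
    · refine ⟨s, ?_⟩
      rw [s, hν, ← pow_add] at s2
      rcases s2 with s2 | s2 | s2 | s2
      · rw [hν, ← pow_add, s2]
      · rw [pow_add, mul_eq_left] at s2
        exact absurd (hν.trans s2) n1
      · exact absurd s2 (algEquiv_pow_ne hφ (by omega))
      · exact absurd s2 (algEquiv_pow_ne hφ (by omega))
    · rw [s, h0, hν, ← pow_add] at s2
      exfalso
      rcases s2 with s2 | s2 | s2 | s2 <;> revert s2
      · exact algEquiv_pow_ne hφ (by omega)
      · exact algEquiv_pow_ne hφ (by omega)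
      · rw [pow_add, mul_eq_right, ← hν]
        exact n1
      · exact algEquiv_pow_ne hφ (by omega)
    · rw [s, h0, hν, ← pow_add] at s2
      exfalso
      rcases s2 with s2 | s2 | s2 | s2 <;> revert s2
      · exact algEquiv_pow_ne hφ (by omega)
      · exact algEquiv_pow_ne hφ (by omega)
      · exact algEquiv_pow_ne hφ (by omega)
      · rw [pow_add, mul_eq_right, ← hν]
        exact n1
  obtain ⟨rfl, h4⟩ := h3
  have hnm : n = 2 * m := by
    rw [hν, ← pow_add] at h4
    have h5 := orderOf_dvd_of_pow_eq_one h4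
    rw [hφ] at h5
    obtain ⟨t, ht⟩ := h5
    have : t = 1 := by nlinarith
    subst this
    omega
  -- In the exceptional case the two twisted terms coincide, so entry `(ρ * σ, ρ)` reads `-2 * v * ρ
  -- (a σ) = 0`.
  have hκρ : κ = ρ := by
    rw [hκ, hρ, hnm]
    congr 1
    ring
  have m1 : ρ * σ ≠ 1 := by
    rw [h0, hρ, hν, ← pow_add]; exact algEquiv_pow_ne hφ (by omega)
  have m2 : ρ * σ ≠ σ := fun e => n5 (mul_eq_right.1 e).symm
  have m3 : ρ * σ ≠ ρ := fun e => n1 (mul_eq_left.1 e)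
  refine h ?_
  have := hE (ρ * σ) ρ
  simp [bierbrauerCoeff, leftCoeff, hκρ, m1, m2, n3.symm, n5.symm, n1] at this
  have h5 : 2 * v * ρ (a σ) = 0 := by linear_combination -this
  simpa using (mul_eq_zero.1 h5).resolve_left hv

omit [Finite F] in
theorem bierbrauerCoeff_one {v : F} {a b : (F ≃ₐ[ZMod p] F) → F}
    {ν κ ρ : F ≃ₐ[ZMod p] F} (hν1 : ν ≠ 1) (hνκ : ν ≠ κ) (hνρ : ν ≠ ρ) (h1κ : 1 ≠ κ) (h1ρ : 1 ≠ ρ)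
    (hv : 2 * v ≠ 0)
    (hE : ∀ σ τ, bierbrauerCoeff ν κ ρ v a σ τ = bierbrauerCoeff ν κ ρ v b τ σ) :
    a 1 = ν (b 1) ∧ b 1 = ν (a 1) ∧ ρ (a 1) = κ (b 1) := by
  refine ⟨?_, ?_, ?_⟩
  · simpa [bierbrauerCoeff, leftCoeff, hν1, hνκ, hνρ, hν1.symm, h1κ, h1ρ] using hE 1 ν
  · simpa [bierbrauerCoeff, leftCoeff, hν1, hνκ, hνρ, hν1.symm, h1κ, h1ρ] using (hE ν 1).symm
  · have h := hE ρ κ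
    by_cases hκρ : κ = ρ
    · subst hκρ
      simp [bierbrauerCoeff, leftCoeff, hνκ.symm, h1κ.symm] at h
      have h5 : 2 * v * (κ (a 1) - κ (b 1)) = 0 := by linear_combination -h
      exact sub_eq_zero.1 ((mul_eq_zero.1 h5).resolve_left hv)
    · simpa [bierbrauerCoeff, leftCoeff, hνκ.symm, h1κ.symm, hνρ.symm, h1ρ.symm, hκρ, Ne.symm hκρ,
        right_ne_zero_of_mul hv] using h

omit [Finite F] in
-- The relations put `φ ^ (2n)` and `φ ^ (2m)` in the stabilizer of `a`; Bézout then gives `φ ^ 2`.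
theorem apply_sq_eq_of_bierbrauer (hcop : m.Coprime n) {a b : F}
    (h1 : a = (φ ^ n) b) (h2 : b = (φ ^ n) a) (h3 : (φ ^ (3 * m)) a = (φ ^ (m + n)) b) :
    (φ ^ 2) a = a := by
  let S := MulAction.stabilizer (F ≃ₐ[ZMod p] F) a
  have mn : φ ^ (2 * n) ∈ S := by
    change (φ ^ (2 * n)) a = a
    rw [two_mul, pow_add, AlgEquiv.mul_apply, ← h2, ← h1]
  have mm : φ ^ (2 * m) ∈ S := by
    change (φ ^ (2 * m)) a = a
    rw [pow_add, AlgEquiv.mul_apply, ← h1] at h3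
    apply (φ ^ m).injective
    rw [← h3, ← AlgEquiv.mul_apply, ← pow_add]
    congr 2
    ring
  have hz : φ ^ 2 = (φ ^ (2 * m)) ^ (m.gcdA n) * (φ ^ (2 * n)) ^ (m.gcdB n) := by
    have := Nat.gcd_eq_gcd_ab m n
    rw [hcop.gcd_eq_one] at this
    simp only [← zpow_natCast, ← zpow_mul, ← zpow_add]
    congr 1
    push_cast at this ⊢
    linear_combination 2 * this
  have : φ ^ 2 ∈ S := hz ▸ S.mul_mem (S.zpow_mem mm _) (S.zpow_mem mn _)
  exact this

end Bierbrauer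

theorem algEquiv_pow_apply_of_sq {K F : Type*} [Field K] [Field F] [Algebra K F]
    {φ : F ≃ₐ[K] F} {a : F} (ha : (φ ^ 2) a = a) (k : ℕ) : (φ ^ (2 * k)) a = a := by
  induction k with
  | zero => simp
  | succ k ih => rw [mul_add, pow_add, AlgEquiv.mul_apply, mul_one, ha, ih]

/-- If `n` were odd, then `gcd (2m, n) = 1` and the quotient would be the even number `2m`.
Coprimality then makes `m` odd. -/
theorem IsBierbrauerData.odd_m_even_n {F : Type*} [Field F] {q m n : ℕ} {u : F}
    (h : IsBierbrauerData F q m n u) : Odd m ∧ Even n := by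
  have ho := h.odd_quot
  have h4 : Even n := by
    by_contra hn
    rw [Nat.not_even_iff_odd] at hn
    have : Nat.gcd (2 * m) n = 1 :=
      Nat.Coprime.mul_left (Nat.coprime_two_left.2 hn) h.coprime
    rw [this, Nat.div_one] at ho
    exact absurd ho (by simp)
  refine ⟨?_, h4⟩
  by_contra hm
  rw [Nat.not_odd_iff_even] at hm
  have := Nat.dvd_gcd hm.two_dvd h4.two_dvd
  rw [h.coprime.gcd_eq_one] at this
  omega

theorem natCast_two_ne_zero_of_odd {F : Type*} [Field F] {p q : ℕ} [Fact p.Prime]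
    [Algebra (ZMod p) F] (hq : Odd q) (hpq : p ∣ q) : (2 : F) ≠ 0 := by
  have : CharP F p := charP_of_injective_algebraMap (algebraMap (ZMod p) F).injective p
  have hp : p ≠ 2 := by
    rintro rfl
    exact (Nat.not_even_iff_odd.2 hq) (even_iff_two_dvd.2 hpq)
  exact Ring.two_ne_zero (by rwa [ringChar.eq F p])

theorem card_middleNucleus_bierbrauerMul {F : Type*} [Field F] {q m n : ℕ} {u : F}
    (h : IsBierbrauerData F q m n u) :
    Nat.card (MiddleNucleus (bierbrauerMul q m n u)) = q ^ 2 := by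
  obtain ⟨p, _, _, φ, hfin, hpq, hφ, hord⟩ := exists_frobenius h.primePow h.card
  obtain ⟨hm, hn⟩ := h.odd_m_even_n
  have hm0 := hm.pos
  have hu : u ≠ 0 := h.primitive.ne_zero (Nat.sub_ne_zero_of_lt
    (Nat.one_lt_pow (by omega) h.primePow.one_lt))
  have hv : 2 * u ^ (q ^ m - 1) ≠ 0 :=
    mul_ne_zero (natCast_two_ne_zero_of_odd h.odd hpq) (pow_ne_zero _ hu)
  rw [← card_fixed_algEquiv (q := q ^ 2) (K := 2 * m) (by omega)
    (by rw [h.card, ← pow_mul]; congr 1; ring) (φ ^ 2)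
    (by rw [orderOf_pow_of_dvd (by simp) (by rw [hord]; omega), hord]; omega)]
  symm
  refine Nat.card_congr (Equiv.ofBijective (fun a => ⟨(.mulLeft a.1, .mulLeft a.1), ?_⟩) ⟨?_, ?_⟩)
  · intro x y
    obtain ⟨a, ha⟩ := a
    have hna : (φ ^ n) a = a := by
      obtain ⟨k, rfl⟩ := hn
      rw [← two_mul]
      exact algEquiv_pow_apply_of_sq ha k
    have hmna : (φ ^ (3 * m)) a = (φ ^ (m + n)) a := by
      rw [pow_add, AlgEquiv.mul_apply, hna, show 3 * m = m + 2 * m by ring, pow_add,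
        AlgEquiv.mul_apply, algEquiv_pow_apply_of_sq ha]
    simp only [algEquiv_pow_apply φ hφ] at hna hmna
    simp only [bierbrauerMul, AddMonoidHom.coe_mulLeft, mul_pow, hna, hmna]
    ring
  · intro a b hab
    have := DFunLike.congr_fun (congrArg (fun P => P.1.1) hab) 1
    simpa [Subtype.ext_iff] using this
  · rintro ⟨⟨A, B⟩, hAB⟩
    obtain ⟨a, ha⟩ := addMonoidHom_eq_sum_algEquiv (p := p) A
    obtain ⟨b, hb⟩ := addMonoidHom_eq_sum_algEquiv (p := p) B
    have hE := bierbrauerCoeff_eq_swap φ hφ ha hb hAB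
    have sa := bierbrauerCoeff_support rfl rfl rfl hord hm hn h.n_pos h.n_lt hv hE
    have sb := bierbrauerCoeff_support rfl rfl rfl hord hm hn h.n_pos h.n_lt hv
      fun σ τ => (hE τ σ).symm
    have h0 : (1 : F ≃ₐ[ZMod p] F) = φ ^ 0 := (pow_zero φ).symm
    obtain ⟨h1, h2, h3⟩ : a 1 = _ ∧ b 1 = _ ∧ _ := by
      obtain ⟨m', hm⟩ := hm
      obtain ⟨n', hn⟩ := hn
      exact bierbrauerCoeff_one (pow_ne_one_of_lt_orderOf h.n_pos.ne' (hord ▸ h.n_lt))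
        (algEquiv_pow_ne hord (by omega)) (algEquiv_pow_ne hord (by omega))
        (h0 ▸ algEquiv_pow_ne hord (by omega)) (h0 ▸ algEquiv_pow_ne hord (by omega)) hv hE
    have hfix := apply_sq_eq_of_bierbrauer h.coprime h1 h2 h3
    have hba : b 1 = a 1 := by
      obtain ⟨k, rfl⟩ := hn
      rw [h2, ← two_mul]
      exact algEquiv_pow_apply_of_sq hfix k
    refine ⟨⟨a 1, hfix⟩, Subtype.ext (Prod.ext ?_ ?_)⟩ <;> ext x
    · change a 1 * x = A x
      rw [ha, Finset.sum_eq_single 1 (fun σ _ hσ => by rw [sa σ hσ, zero_mul]) (by simp)]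
      simp
    · change a 1 * x = B x
      rw [hb, Finset.sum_eq_single 1 (fun σ _ hσ => by rw [sb σ hσ, zero_mul]) (by simp)]
      simp [hba]

/-! ### The middle nucleus of a Budaghyan–Helleseth presemifield -/

section BudaghyanHelleseth

variable {p : ℕ} {F : Type*} [Field F] [Finite F] [Fact p.Prime] [Algebra (ZMod p) F]

/-- Coefficients of `A x * η y + η (A x) * y`, where `A x = ∑ σ, a σ * σ x`. -/
noncomputable def bhCoeffFst (η : F ≃ₐ[ZMod p] F) (a : (F ≃ₐ[ZMod p] F) → F) :
    (F ≃ₐ[ZMod p] F) → (F ≃ₐ[ZMod p] F) → F :=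
  leftCoeff 1 1 η a + leftCoeff 1 η 1 a

/-- Coefficients of `β * (A x * δ y + δ (A x) * y) + β' * (η (A x) * ψ y + ψ (A x) * η y)`,
where `A x = ∑ σ, a σ * σ x`. -/
noncomputable def bhCoeffSnd (η δ ψ : F ≃ₐ[ZMod p] F) (β β' : F) (a : (F ≃ₐ[ZMod p] F) → F) :
    (F ≃ₐ[ZMod p] F) → (F ≃ₐ[ZMod p] F) → F :=
  leftCoeff β 1 δ a + leftCoeff β δ 1 a + leftCoeff β' η ψ a + leftCoeff β' ψ η a

theorem autBilin_bhCoeffFst (η : F ≃ₐ[ZMod p] F)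
    {A : F → F} {a : (F ≃ₐ[ZMod p] F) → F} (ha : ∀ x, A x = ∑ σ, a σ * σ x) (x y : F) :
    autBilin (bhCoeffFst η a) x y = A x * η y + η (A x) * y := by
  simp only [bhCoeffFst, autBilin_add, autBilin_leftCoeff, ← ha, AlgEquiv.one_apply, one_mul]

theorem autBilin_bhCoeffSnd (η δ ψ : F ≃ₐ[ZMod p] F) (β β' : F)
    {A : F → F} {a : (F ≃ₐ[ZMod p] F) → F} (ha : ∀ x, A x = ∑ σ, a σ * σ x) (x y : F) :
    autBilin (bhCoeffSnd η δ ψ β β' a) x y =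
      β * (A x * δ y + δ (A x) * y) + β' * (η (A x) * ψ y + ψ (A x) * η y) := by
  simp only [bhCoeffSnd, autBilin_add, autBilin_leftCoeff, ← ha, AlgEquiv.one_apply]
  ring

omit [Finite F] in
theorem bhMul_eq {q ℓ d : ℕ} {β ω : F} {φ : F ≃ₐ[ZMod p] F} (hφ : ∀ x, φ x = x ^ q) (x y : F) :
    bhMul q ℓ d β ω x y = x * (φ ^ ℓ) y + (φ ^ ℓ) x * y +
      (β * (x * (φ ^ d) y + (φ ^ d) x * y) +
        (φ ^ ℓ) β * ((φ ^ ℓ) x * (φ ^ (ℓ + d)) y + (φ ^ (ℓ + d)) x * (φ ^ ℓ) y)) * ω := by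
  simp only [pow_add φ ℓ d, AlgEquiv.mul_apply, ← map_mul, ← map_add]
  simp only [bhMul, algEquiv_pow_apply φ hφ, mul_pow]

/-- Adding the equation to its image under `η` cancels the `ω` part. This splits the product into
two independent identities. -/
theorem eq_and_eq_of_add_mul_eq {K F : Type*} [Field K] [Field F] [Algebra K F] (h2 : (2 : F) ≠ 0)
    {η : F ≃ₐ[K] F} {ω u u' w w' : F} (hω0 : ω ≠ 0) (hω : η ω = -ω) (hu : η u = u) (hu' : η u' = u')
    (hw : η w = w) (hw' : η w' = w') (h : u + w * ω = u' + w' * ω) : u = u' ∧ w = w' := by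
  have h' := congrArg η h
  simp only [map_add, map_mul, hω, hu, hu', hw, hw'] at h'
  have h1 : u = u' := mul_left_cancel₀ h2 (by linear_combination h + h')
  subst h1
  exact ⟨rfl, mul_right_cancel₀ hω0 (add_left_cancel h)⟩

omit [Finite F] in
theorem bhMul_eq_iff {q ℓ d : ℕ} {β ω : F} {φ : F ≃ₐ[ZMod p] F} (hφ : ∀ x, φ x = x ^ q)
    (h2 : (2 : F) ≠ 0) (hω0 : ω ≠ 0) (hη : φ ^ ℓ * φ ^ ℓ = 1) (hω : (φ ^ ℓ) ω = -ω)
    {x y x' y' : F} (h : bhMul q ℓ d β ω x y = bhMul q ℓ d β ω x' y') :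
    x * (φ ^ ℓ) y + (φ ^ ℓ) x * y = x' * (φ ^ ℓ) y' + (φ ^ ℓ) x' * y' ∧
      β * (x * (φ ^ d) y + (φ ^ d) x * y) +
        (φ ^ ℓ) β * ((φ ^ ℓ) x * (φ ^ (ℓ + d)) y + (φ ^ (ℓ + d)) x * (φ ^ ℓ) y) =
      β * (x' * (φ ^ d) y' + (φ ^ d) x' * y') +
        (φ ^ ℓ) β * ((φ ^ ℓ) x' * (φ ^ (ℓ + d)) y' + (φ ^ (ℓ + d)) x' * (φ ^ ℓ) y') := by
  have hη' : ∀ z, (φ ^ ℓ) ((φ ^ ℓ) z) = z := fun z => by rw [← AlgEquiv.mul_apply, hη]; rfl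
  rw [bhMul_eq hφ, bhMul_eq hφ] at h
  refine eq_and_eq_of_add_mul_eq h2 hω0 hω ?_ ?_ ?_ ?_ h <;>
  · simp only [map_add, map_mul, hη', pow_add φ ℓ d, AlgEquiv.mul_apply]
    ring

variable {η δ ψ : F ≃ₐ[ZMod p] F} {β : F} {a b : (F ≃ₐ[ZMod p] F) → F}

omit [Finite F] in
theorem bhCoeffFst_support (hη : η ≠ 1)
    (h : ∀ σ τ, bhCoeffFst η a σ τ = bhCoeffFst η b τ σ) (σ : F ≃ₐ[ZMod p] F) (h1 : σ ≠ 1)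
    (h2 : σ ≠ η) : a σ = 0 := by
  simpa [bhCoeffFst, leftCoeff, hη, h1, h2] using h σ η

omit [Finite F] in
theorem bhCoeffFst_values (hη : η ≠ 1)
    (h : ∀ σ τ, bhCoeffFst η a σ τ = bhCoeffFst η b τ σ) : a 1 = η (b 1) ∧ a η = b η :=
  ⟨by simpa [bhCoeffFst, leftCoeff, hη, hη.symm] using h 1 η,
    by simpa [bhCoeffFst, leftCoeff, hη] using h η η⟩

omit [Finite F] in
theorem bhCoeffSnd_values {β' : F} (hβ : β ≠ 0) (hη : η ≠ 1) (hδ : δ ≠ 1) (hψ : ψ ≠ 1) (hδη : δ ≠ η)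
    (hψη : ψ ≠ η) (hψδ : ψ ≠ δ) (hψinv : ψ⁻¹ * δ = η)
    (h : ∀ σ τ, bhCoeffSnd η δ ψ β β' a σ τ = bhCoeffSnd η δ ψ β β' b τ σ) :
    a 1 = δ (b 1) ∧ β * a η = β' * ψ (b η) := by
  constructor
  · simpa [bhCoeffSnd, leftCoeff, hη.symm, hδ, hδ.symm, hψ.symm, hδη, hψδ.symm, hβ] using h 1 δ
  · simpa [bhCoeffSnd, leftCoeff, hη, hδ, hδη, hδη.symm, hψη.symm, hψδ.symm, hψinv] using h η δ

omit [Finite F] in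
-- The inverse of the partial norm `∏ ψ ^ i β`, `i < ℓ`, works by telescoping. It makes the
-- solutions `c` of this twisted equation a line over the fixed field of `ψ`.
theorem exists_mul_eq_mul_apply {ℓ : ℕ} (hβ : β ≠ 0) (hψ : ψ ^ ℓ = η) :
    ∃ c : F, c ≠ 0 ∧ β * c = η β * ψ c := by
  have hne : ∀ i, (ψ ^ i) β ≠ 0 := fun i => (map_ne_zero (ψ ^ i)).2 hβ
  refine ⟨∏ i ∈ Finset.range ℓ, ((ψ ^ i) β)⁻¹, Finset.prod_ne_zero_iff.2 fun i _ =>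
    inv_ne_zero (hne i), ?_⟩
  have h := (Finset.prod_range_succ (fun i => ((ψ ^ i) β)⁻¹) ℓ).symm.trans
    (Finset.prod_range_succ' _ ℓ)
  have e : ψ (∏ i ∈ Finset.range ℓ, ((ψ ^ i) β)⁻¹) =
      ∏ i ∈ Finset.range ℓ, ((ψ ^ (i + 1)) β)⁻¹ := by
    rw [map_prod]
    exact Finset.prod_congr rfl fun i _ => by rw [map_inv₀, pow_succ', AlgEquiv.mul_apply]
  rw [← e, hψ, pow_zero, AlgEquiv.one_apply] at h
  have hηβ : η β ≠ 0 := hψ ▸ hne ℓ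
  generalize ∏ i ∈ Finset.range ℓ, ((ψ ^ i) β)⁻¹ = c at h ⊢
  field_simp at h
  linear_combination h

/-- By coprimality the alternative is that both are odd. Then an element negated by `φ` is negated
by `φ ^ ℓ` and `φ ^ d`, a forbidden common root. -/
theorem IsBHData.odd_add {F : Type*} [Field F] {q ℓ d : ℕ} {β ω : F} (h : IsBHData F q ℓ d β ω) :
    Odd (ℓ + d) := by
  by_contra hodd
  obtain ⟨p, _, _, φ, hfin, hpq, hφ, hord⟩ := exists_frobenius h.primePow h.card
  have hℓd : Odd ℓ ∧ Odd d := by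
    rw [Nat.odd_add, not_iff] at hodd
    by_contra hc
    have hℓ : ¬ Odd ℓ := fun h => hc ⟨h, Nat.not_even_iff_odd.1 fun hd => hodd.2 hd h⟩
    have hd : ¬ Odd d := fun hd => hℓ (by_contra fun h =>
      Nat.not_even_iff_odd.2 hd (hodd.1 h))
    rw [Nat.not_odd_iff_even] at hℓ hd
    have := Nat.dvd_gcd hℓ.two_dvd hd.two_dvd
    rw [h.coprime.gcd_eq_one] at this
    omega
  have hℓ0 : ℓ ≠ 0 := hℓd.1.pos.ne'
  have c1 := card_fixed_algEquiv (by omega) h.card φ hord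
  have c2 := card_fixed_algEquiv (q := q ^ 2) hℓ0 (by rw [h.card, pow_mul]) (φ ^ 2)
    (by rw [orderOf_pow_of_dvd (by simp) (by rw [hord]; omega), hord]; omega)
  -- Such an `x` exists because the fixed fields have orders `q ^ 2 > q`; `x - φ x` is then negated
  -- by `φ`.
  obtain ⟨x, hx2, hx1⟩ : ∃ x, (φ ^ 2) x = x ∧ φ x ≠ x := by
    by_contra! hc
    have := Nat.card_le_card_of_injective
      (fun x : {x // (φ ^ 2) x = x} => (⟨x.1, hc x.1 x.2⟩ : {x // φ x = x}))
      (fun x y hxy => by simpa [Subtype.ext_iff] using hxy)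
    rw [c1, c2] at this
    have := h.primePow.one_lt
    nlinarith
  rw [pow_two, AlgEquiv.mul_apply] at hx2
  have ha : φ (x - φ x) = -(x - φ x) := by rw [map_sub, hx2]; ring
  have hodd : ∀ k, Odd k → (φ ^ k) (x - φ x) = -(x - φ x) := by
    rintro _ ⟨k, rfl⟩
    rw [pow_succ', AlgEquiv.mul_apply, algEquiv_pow_apply_of_sq, ha]
    rw [pow_two, AlgEquiv.mul_apply, ha, map_neg, ha, neg_neg]
  refine h.no_common_root ⟨x - φ x, sub_ne_zero.2 (Ne.symm hx1), ?_, ?_⟩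
  · rw [← algEquiv_pow_apply φ hφ, hodd _ hℓd.1, add_neg_cancel]
  · rw [← algEquiv_pow_apply φ hφ, hodd _ hℓd.2, add_neg_cancel]

theorem card_middleNucleus_bhMul {F : Type*} [Field F] {q ℓ d : ℕ} {β ω : F}
    (h : IsBHData F q ℓ d β ω) : Nat.card (MiddleNucleus (bhMul q ℓ d β ω)) = q ^ 2 := by
  obtain ⟨p, _, _, φ, hfin, hpq, hφ, hord⟩ := exists_frobenius h.primePow h.card
  have h2 : (2 : F) ≠ 0 := natCast_two_ne_zero_of_odd h.odd hpq
  have hodd := h.odd_add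
  have hd0 := h.d_pos
  have hd2 := h.d_lt
  have hℓ0 : 0 < ℓ := by omega
  have hω0 : ω ≠ 0 := fun e => h.omega_notMem (by
    rw [e, zero_pow (pow_ne_zero _ h.primePow.pos.ne')])
  have hω : (φ ^ ℓ) ω = -ω := by rw [algEquiv_pow_apply φ hφ, h.omega_conj]
  have hη : φ ^ ℓ * φ ^ ℓ = 1 := by rw [← pow_add, ← two_mul, ← hord, pow_orderOf_eq_one]
  have hη' : ∀ z, (φ ^ ℓ) ((φ ^ ℓ) z) = z := fun z => by rw [← AlgEquiv.mul_apply, hη]; rfl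
  have hηδ : ∀ z, (φ ^ d) ((φ ^ ℓ) z) = (φ ^ ℓ) ((φ ^ d) z) := fun z => by
    rw [← AlgEquiv.mul_apply, ← AlgEquiv.mul_apply, ← pow_add, ← pow_add, add_comm]
  have hψ : ∀ z, (φ ^ (ℓ + d)) z = (φ ^ ℓ) ((φ ^ d) z) := fun z => by
    rw [pow_add, AlgEquiv.mul_apply]
  -- Oddness of `ℓ + d` enters here, and again in the coprimality of `ℓ + d` with `2ℓ` below.
  have hψℓ : (φ ^ (ℓ + d)) ^ ℓ = φ ^ ℓ := by
    obtain ⟨k, hk⟩ := hodd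
    rw [← pow_mul, hk, show (2 * k + 1) * ℓ = (2 * ℓ) * k + ℓ by ring, pow_add, pow_mul, ← hord,
      pow_orderOf_eq_one, one_pow, one_mul]
  have hψord : orderOf (φ ^ (ℓ + d)) = 2 * ℓ := by
    rw [Nat.Coprime.orderOf_pow, hord]
    rw [hord]
    exact Nat.Coprime.mul_left (Nat.coprime_two_left.2 hodd) (by simpa using h.coprime)
  have hcard := card_fixed_algEquiv (by omega) h.card _ hψord
  obtain ⟨c₀, hc₀, hβc₀⟩ := exists_mul_eq_mul_apply h.beta_ne_zero hψℓ
  have hsq : q ^ 2 = Nat.card ({x // (φ ^ (ℓ + d)) x = x} × {x // (φ ^ (ℓ + d)) x = x}) := by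
    rw [Nat.card_prod, hcard, pow_two]
  rw [hsq]
  symm
  refine Nat.card_congr (Equiv.ofBijective (fun P => ⟨(
    .mulLeft P.1.1 + (AddMonoidHom.mulLeft (c₀ * P.2.1)).comp (φ ^ ℓ : F ≃ₐ[ZMod p] F).toAddEquiv,
    .mulLeft ((φ ^ ℓ) P.1.1) +
      (AddMonoidHom.mulLeft (c₀ * P.2.1)).comp (φ ^ ℓ : F ≃ₐ[ZMod p] F).toAddEquiv), ?_⟩) ⟨?_, ?_⟩)
  · intro x y
    obtain ⟨⟨a, ha⟩, ⟨e, he⟩⟩ := P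
    change bhMul q ℓ d β ω (a * x + c₀ * e * (φ ^ ℓ) x) y =
      bhMul q ℓ d β ω x ((φ ^ ℓ) a * y + c₀ * e * (φ ^ ℓ) y)
    obtain ⟨c, hc⟩ : ∃ c, c = c₀ * e := ⟨_, rfl⟩
    have hβc : β * c = (φ ^ ℓ) β * (φ ^ ℓ) ((φ ^ d) c) := by
      rw [← hψ, hc, map_mul, he]
      linear_combination e * hβc₀
    have hβc' := congrArg (φ ^ ℓ) hβc
    rw [hψ] at ha
    have ha' := congrArg (φ ^ ℓ) ha
    rw [hη'] at ha'
    simp only [map_mul, hη'] at hβc'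
    rw [← hc, bhMul_eq hφ, bhMul_eq hφ]
    simp only [hψ, map_add, map_mul, hη', hηδ, ha']
    linear_combination ω * ((φ ^ ℓ) x * (φ ^ d) y - (φ ^ d) x * (φ ^ ℓ) y) * hβc +
      ω * (x * (φ ^ ℓ) ((φ ^ d) y) - (φ ^ ℓ) ((φ ^ d) x) * y) * hβc'
  · rintro ⟨⟨a, ha⟩, ⟨e, he⟩⟩ ⟨⟨a', ha'⟩, ⟨e', he'⟩⟩ hPP
    have hx : ∀ x, a * x + c₀ * e * (φ ^ ℓ) x = a' * x + c₀ * e' * (φ ^ ℓ) x :=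
      DFunLike.congr_fun (congrArg (fun P => P.1.1) hPP)
    have h1 := hx 1
    have hω' := hx ω
    rw [map_one] at h1
    rw [hω] at hω'
    have hωω : a - c₀ * e = a' - c₀ * e' := mul_right_cancel₀ hω0 (by linear_combination hω')
    have haa : a = a' := mul_left_cancel₀ h2 (by linear_combination h1 + hωω)
    subst haa
    have hee : e = e' := mul_left_cancel₀ hc₀ (by linear_combination h1)
    subst hee
    rfl
  · rintro ⟨⟨A, B⟩, hAB⟩
    obtain ⟨a, ha⟩ := addMonoidHom_eq_sum_algEquiv (p := p) A
    obtain ⟨b, hb⟩ := addMonoidHom_eq_sum_algEquiv (p := p) B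
    have hsplit := fun x y => bhMul_eq_iff hφ h2 hω0 hη hω (hAB x y)
    have hE1 : ∀ σ τ, bhCoeffFst (φ ^ ℓ) a σ τ = bhCoeffFst (φ ^ ℓ) b τ σ := by
      refine congrFun₂ (autBilin_injective (c' := fun σ τ => bhCoeffFst (φ ^ ℓ) b τ σ)
        fun x y => ?_)
      rw [autBilin_swap (bhCoeffFst _ b), autBilin_bhCoeffFst _ ha, autBilin_bhCoeffFst _ hb]
      linear_combination (hsplit x y).1
    have hE2 : ∀ σ τ, bhCoeffSnd (φ ^ ℓ) (φ ^ d) (φ ^ (ℓ + d)) β ((φ ^ ℓ) β) a σ τ =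
        bhCoeffSnd (φ ^ ℓ) (φ ^ d) (φ ^ (ℓ + d)) β ((φ ^ ℓ) β) b τ σ := by
      refine congrFun₂ (autBilin_injective (c' := fun σ τ =>
        bhCoeffSnd (φ ^ ℓ) (φ ^ d) (φ ^ (ℓ + d)) β ((φ ^ ℓ) β) b τ σ) fun x y => ?_)
      rw [autBilin_swap (bhCoeffSnd _ _ _ _ _ b), autBilin_bhCoeffSnd _ _ _ _ _ ha,
        autBilin_bhCoeffSnd _ _ _ _ _ hb]
      linear_combination (hsplit x y).2
    have n1 : φ ^ ℓ ≠ 1 := pow_ne_one_of_lt_orderOf hℓ0.ne' (by omega)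
    have n2 : φ ^ d ≠ 1 := pow_ne_one_of_lt_orderOf hd0.ne' (by omega)
    have n3 : φ ^ d ≠ φ ^ ℓ := fun e => by
      have := pow_injOn_Iio_orderOf (show d < orderOf φ by omega) (show ℓ < orderOf φ by omega) e
      subst this
      exact absurd hodd (by simp)
    have n4 : φ ^ (ℓ + d) ≠ 1 := fun e => by
      refine n3 (mul_left_cancel (a := φ ^ ℓ) ?_)
      rw [← pow_add, e, hη]
    have n5 : φ ^ (ℓ + d) ≠ φ ^ ℓ := fun e => n2 (by rwa [pow_add, mul_eq_left] at e)
    have n6 : φ ^ (ℓ + d) ≠ φ ^ d := fun e => n1 (by rwa [pow_add, mul_eq_right] at e)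
    have n7 : (φ ^ (ℓ + d))⁻¹ * φ ^ d = φ ^ ℓ := by
      rw [inv_mul_eq_iff_eq_mul, add_comm, pow_add, mul_assoc, hη, mul_one]
    have sa := bhCoeffFst_support n1 hE1
    have sb := bhCoeffFst_support n1 fun σ τ => (hE1 τ σ).symm
    obtain ⟨v1, v2⟩ := bhCoeffFst_values n1 hE1
    obtain ⟨w1, w2⟩ := bhCoeffSnd_values h.beta_ne_zero n1 n2 n4 n3 n5 n6 n7 hE2
    rw [← v2] at w2
    have hb1 : b 1 = (φ ^ ℓ) (a 1) := by rw [v1, hη']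
    have ha1 : (φ ^ (ℓ + d)) (a 1) = a 1 := by rw [hψ, ← hηδ, ← hb1, ← w1]
    -- Both `a (φ ^ ℓ)` and `c₀` solve `β * c = η β * ψ c`, with `η = φ ^ ℓ`, so their ratio is
    -- fixed by `ψ`.
    have hc1 : (φ ^ (ℓ + d)) (a (φ ^ ℓ) / c₀) = a (φ ^ ℓ) / c₀ := by
      have hβ := h.beta_ne_zero
      have e1 : (φ ^ (ℓ + d)) c₀ ≠ 0 := (map_ne_zero (φ ^ (ℓ + d))).2 hc₀
      have e2 : (φ ^ ℓ) β ≠ 0 := (map_ne_zero (φ ^ ℓ)).2 hβ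
      rw [map_div₀, div_eq_div_iff e1 hc₀]
      apply mul_left_cancel₀ (mul_ne_zero hβ e2)
      linear_combination β * a (φ ^ ℓ) * hβc₀ - β * c₀ * w2
    refine ⟨⟨⟨a 1, ha1⟩, ⟨_, hc1⟩⟩, Subtype.ext (Prod.ext ?_ ?_)⟩ <;> ext x
    · change a 1 * x + c₀ * (a (φ ^ ℓ) / c₀) * (φ ^ ℓ) x = A x
      rw [ha, Finset.sum_eq_add 1 (φ ^ ℓ) n1.symm
        (fun σ _ hσ => by rw [sa σ hσ.1 hσ.2, zero_mul]) (by simp) (by simp), mul_div_cancel₀ _ hc₀]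
      rfl
    · change (φ ^ ℓ) (a 1) * x + c₀ * (a (φ ^ ℓ) / c₀) * (φ ^ ℓ) x = B x
      rw [hb, Finset.sum_eq_add 1 (φ ^ ℓ) n1.symm
        (fun σ _ hσ => by rw [sb σ hσ.1 hσ.2, zero_mul]) (by simp) (by simp), mul_div_cancel₀ _ hc₀,
        hb1, v2]
      rfl

end BudaghyanHelleseth

/-! ### Comparison of nuclei and orders -/

theorem mainTheorem7
    {F : Type*} [Field F] (q ℓ d : ℕ) (β ω : F) (hBH : IsBHData F q ℓ d β ω)
    (hℓ : ¬ ∃ k : ℕ, Odd k ∧ ℓ = 2 * k)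
    {F' : Type*} [Field F'] (q' m n : ℕ) (u : F') (hB : IsBierbrauerData F' q' m n u) :
    ¬ PresemifieldIsotopic (bhMul q ℓ d β ω) (bierbrauerMul q' m n u) := by
  intro h
  have hq := h.card_middleNucleus
  rw [card_middleNucleus_bhMul hBH, card_middleNucleus_bierbrauerMul hB] at hq
  obtain rfl : q = q' := Nat.pow_left_injective two_ne_zero hq
  obtain ⟨g, -⟩ := h
  have hcard := Nat.card_congr g.toEquiv
  rw [hBH.card, hB.card] at hcard
  have := Nat.pow_right_injective hBH.primePow.one_lt hcard
  exact hℓ ⟨m, hB.odd_m_even_n.1, by omega⟩
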